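/- Call a finite-dimensional complex Lie algebra $\mathfrak{a}$ with center $\mathfrak{z}$ quasi-reductive if there is a linear form $f\in\mathfrak{a}^*$ of reductive type, i.e. such that, for the coadjoint stabilizer $\mathfrak{a}(f)=\{x\in\mathfrak{a} : f([x,y])=0 \text{ for all } y\in\mathfrak{a}\}$, the quotient $\mathfrak{a}(f)/\mathfrak{z}$ is a reductive Lie algebra whose center consists of semisimple elements (where $\mathfrak{a}(f)/\mathfrak{z}$ is regarded as a subalgebra of $\mathfrak{gl}(\mathfrak{a})$ through the adjoint representation). **Theorem 5.7.** Let $\mathfrak{g}$ be a complex simple Lie algebra of type $E_6$ with a triangular decomposition $\mathfrak{g}=\mathfrak{n}^+\oplus\mathfrak{h}\oplus\mathfrak{n}^-$ and set of simple roots $\pi=\{\alpha_1,\dots,\alpha_6\}$ in Bourbaki's numbering (so $\alpha_1,\alpha_3,\alpha_4,\alpha_5,\alpha_6$ form a chain in this order and $\alpha_2$ is joined to $\alpha_4$). For $\pi''\subset\pi$ let $\mathfrak{p}^+_{\pi''}$ be the standard parabolic subalgebra, generated by $\mathfrak{h}\oplus\mathfrak{n}^+$ and the root spaces $\mathfrak{g}_{-\alpha}$,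 $\alpha\in\pi''$. Then $\mathfrak{p}^+_{\pi''}$ is quasi-reductive for $\pi''=\{\alpha_1,\alpha_2,\alpha_4\}$ and for $\pi''=\{\alpha_1,\alpha_2,\alpha_4,\alpha_6\}$. -/

import Mathlib

/-! ### The coadjoint stabilizer and quasi-reductive Lie algebras -/

section QuasiReductive

/-- The stabilizer `𝔞(f) = {x ∈ 𝔞 | (ad* x) f = 0}` of a linear form `f` on a Lie algebra `𝔞` for the
coadjoint representation; since `((ad* x) f) y = - f ⁅x, y⁆`, it consists of the `x` such that
`f ⁅x, y⁆ = 0` for all `y`. -/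
def coadjointStabilizer {𝔞 : Type*} [LieRing 𝔞] [LieAlgebra ℂ 𝔞] (f : Module.Dual ℂ 𝔞) :
    LieSubalgebra ℂ 𝔞 where
  carrier := {x | ∀ y : 𝔞, f ⁅x, y⁆ = 0}
  zero_mem' := by intro y; simp
  add_mem' := by
    intro x x' hx hx' y
    rw [add_lie, map_add, hx y, hx' y, add_zero]
  smul_mem' := by
    intro c x hx y
    rw [smul_lie, map_smul, hx y, smul_zero]
  lie_mem' := by
    intro x x' hx hx' y
    rw [lie_lie, map_sub, hx, hx', sub_zero]

/-- The stabilizer is the annihilator of `f` for Mathlib's coadjoint action on the dual. -/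
theorem mem_coadjointStabilizer_iff {𝔞 : Type*} [LieRing 𝔞] [LieAlgebra ℂ 𝔞]
    (f : Module.Dual ℂ 𝔞) (x : 𝔞) : x ∈ coadjointStabilizer f ↔ ⁅x, f⁆ = 0 := by
  constructor
  · intro h
    ext y
    have hy : f ⁅x, y⁆ = 0 := h y
    simp [hy]
  · intro h y
    have hy := LinearMap.congr_fun h y
    simpa using hy

/-- The centre `𝔷` of `𝔞`, viewed as an ideal of the stabilizer `𝔞(f)`, in which it is contained. -/
def centerInStabilizer {𝔞 : Type*} [LieRing 𝔞] [LieAlgebra ℂ 𝔞] (f : Module.Dual ℂ 𝔞) :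
    LieIdeal ℂ (coadjointStabilizer f) :=
  LieIdeal.comap (coadjointStabilizer f).incl (LieAlgebra.center ℂ 𝔞)

/-- A linear form `f` on `𝔞` is of reductive type if `𝔞(f)/𝔷` is a reductive Lie algebra (its
radical is its centre) whose centre consists of semisimple elements.  Here `𝔞(f)/𝔷` is regarded
as a subalgebra of `𝔤𝔩(𝔞)` through the adjoint representation of `𝔞`, whose kernel is `𝔷`; so the
class of `x` is semisimple when `ad x` is a semisimple endomorphism of `𝔞`. -/
def IsOfReductiveType {𝔞 : Type*} [LieRing 𝔞] [LieAlgebra ℂ 𝔞] (f : Module.Dual ℂ 𝔞) : Prop :=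
  LieAlgebra.HasCentralRadical ℂ (coadjointStabilizer f ⧸ centerInStabilizer f) ∧
    ∀ x : coadjointStabilizer f,
      LieSubmodule.Quotient.mk' (centerInStabilizer f) x ∈
        LieAlgebra.center ℂ (coadjointStabilizer f ⧸ centerInStabilizer f) →
      (LieAlgebra.ad ℂ 𝔞 (x : 𝔞)).IsSemisimple

/-- A complex Lie algebra is quasi-reductive if it has a linear form of reductive type. -/
def IsQuasiReductive (𝔞 : Type*) [LieRing 𝔞] [LieAlgebra ℂ 𝔞] : Prop :=
  ∃ f : Module.Dual ℂ 𝔞, IsOfReductiveType f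

end QuasiReductive

/-! ### Standard parabolic subalgebras -/

section Parabolic

/-- The standard parabolic subalgebra `𝔭⁺_{π'}` attached to a Cartan subalgebra `𝔥`, a base `π` of
the root system (the simple roots `b.support`) and a subset `π'` of `π`: the subalgebra generated
by `𝔥`, by the root spaces `𝔤_α` for all positive roots `α` (these generate `𝔟⁺ = 𝔥 ⊕ 𝔫⁺`), and by
`𝔤_{-α}` for `α ∈ π'`. -/
def standardParabolic {𝔤 : Type*} [LieRing 𝔤] [LieAlgebra ℂ 𝔤] [FiniteDimensional ℂ 𝔤]
    [LieAlgebra.IsKilling ℂ 𝔤] (𝔥 : LieSubalgebra ℂ 𝔤) [𝔥.IsCartanSubalgebra]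
    (b : (LieAlgebra.IsKilling.rootSystem 𝔥).Base) (π' : Set b.support) :
    LieSubalgebra ℂ 𝔤 :=
  LieSubalgebra.lieSpan ℂ 𝔤
    ((𝔥 : Set 𝔤) ∪
      (⋃ α : {α : 𝔥.root // b.IsPos α},
        (LieAlgebra.rootSpace 𝔥 (α.1.1 : 𝔥 → ℂ) : Set 𝔤)) ∪
      (⋃ α ∈ π', (LieAlgebra.rootSpace 𝔥 (-(α.1.1 : 𝔥 → ℂ)) : Set 𝔤)))

end Parabolic

/-!
A linear form on a subalgebra `𝔞` of `𝔤` whose coadjoint stabilizer lies in the Cartan subalgebra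
`𝔥` is of reductive type: its stabilizer is then abelian and consists of `ad`-semisimple elements
(`isOfReductiveType_of_stabilizer_le_cartan`). So for each of the two parabolic subalgebras `𝔭` it
suffices to find a form `φ` for which every `x ∈ 𝔭` with `φ ⁅x, 𝔭⁆ = 0` is in `𝔥`.

The form is Killing dual to `h₀ + ∑ e_{-s}`, where `h₀ ∈ 𝔥` and `s` runs over a linearly
independent set `S` of three or four roots of `𝔭`, chosen as follows. Write `s₁ = α₃ + α₄ + α₅`,
`s₂ = α₁ + α₃ + α₄ + α₅ + α₆`, and let `θ` be the highest root; these are orthogonal.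

* For `{α₁, α₂, α₄}`: `S = {-α₁, s₁, s₂, θ}`, and `h₀` is the fundamental coweight of `α₄`.
* For `{α₁, α₂, α₄, α₆}`: `S = {s₁, s₂, θ}`, and `h₀` is the sum of the fundamental coweights of
  `α₄` and `α₆`.

Decompose `x = h + ∑ x_v` with `x_v ∈ 𝔤_v`. Testing `φ ⁅x, ·⁆ = 0` on `𝔥` gives `x_s = 0` for `s ∈
S`. Testing it on `𝔤_w` for `w ∉ S` gives an equation involving only the `x_v` with `v + w ∈ S`,
or `v = -w` and `v(h₀) ≠ 0` (the relation `E6Adj`), and all the coefficients in it are nonzero,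
because brackets of root spaces are nonzero whenever they can be (`lie_ne_zero_of_mem_rootSpace`).
Most of these equations can be solved one unknown at a time (`e6Eliminate`). What resists is a
hexagon of roots `A, B, C, A + α₄, B + α₄, C + α₄`, whose determinant has two terms, that might
cancel. They do not: as the sums of two of `A, B, C` are not roots, the Jacobi identity makes the
`3 × 3` matrix of the pairing symmetric with zero diagonal, of determinant `2xyz ≠ 0`
(`eq_zero_of_hexagon`).

The roots of `𝔤` are handled through their coordinates in the simple roots, listed in `e6Roots`;
this list is complete because it is stable under the simple reflections.
-/

open LieAlgebra LieAlgebra.IsKilling LieModule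

/-! ### The roots of `E₆` in coordinates -/

/-- Integral combinations of the six simple roots, by their coordinates in Bourbaki's numbering. -/
abbrev E6Vec := Fin 6 → ℤ

/-- The coordinates of the 36 positive roots of `E₆`, by increasing height. -/
def e6PosRoots : List E6Vec :=
  [![1, 0, 0, 0, 0, 0], ![0, 1, 0, 0, 0, 0], ![0, 0, 1, 0, 0, 0], ![0, 0, 0, 1, 0, 0],
   ![0, 0, 0, 0, 1, 0], ![0, 0, 0, 0, 0, 1], ![1, 0, 1, 0, 0, 0], ![0, 1, 0, 1, 0, 0],
   ![0, 0, 1, 1, 0, 0], ![0, 0, 0, 1, 1, 0], ![0, 0, 0, 0, 1, 1], ![1, 0, 1, 1, 0, 0],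
   ![0, 1, 1, 1, 0, 0], ![0, 1, 0, 1, 1, 0], ![0, 0, 1, 1, 1, 0], ![0, 0, 0, 1, 1, 1],
   ![1, 1, 1, 1, 0, 0], ![1, 0, 1, 1, 1, 0], ![0, 1, 1, 1, 1, 0], ![0, 1, 0, 1, 1, 1],
   ![0, 0, 1, 1, 1, 1], ![1, 1, 1, 1, 1, 0], ![1, 0, 1, 1, 1, 1], ![0, 1, 1, 2, 1, 0],
   ![0, 1, 1, 1, 1, 1], ![1, 1, 1, 2, 1, 0], ![1, 1, 1, 1, 1, 1], ![0, 1, 1, 2, 1, 1],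
   ![1, 1, 2, 2, 1, 0], ![1, 1, 1, 2, 1, 1], ![0, 1, 1, 2, 2, 1], ![1, 1, 2, 2, 1, 1],
   ![1, 1, 1, 2, 2, 1], ![1, 1, 2, 2, 2, 1], ![1, 1, 2, 3, 2, 1], ![1, 2, 2, 3, 2, 1]]

/-- The coordinates of the 72 roots of `E₆`. -/
def e6Roots : List E6Vec := e6PosRoots ++ e6PosRoots.map (fun v => -v)

/-- The pairing of a vector with the `i`-th simple coroot. -/
def e6Pairing (v : E6Vec) (i : Fin 6) : ℤ := ∑ j, v j * CartanMatrix.E₆ j i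

/-- The `i`-th simple reflection, in coordinates. -/
def e6Reflect (i : Fin 6) (v : E6Vec) : E6Vec := v - e6Pairing v i • Pi.single i 1

/-- The squared norm of a vector for the invariant form in which roots have squared norm `2`. -/
def e6Norm (v : E6Vec) : ℤ := ∑ i, v i * e6Pairing v i

theorem single_mem_e6PosRoots : ∀ i : Fin 6, Pi.single i 1 ∈ e6PosRoots := by
  decide +kernel

theorem e6Norm_posRoots : ∀ v ∈ e6PosRoots, e6Norm v = 2 := by
  decide +kernel

theorem e6Reflect_mem_of_mem_posRoots : ∀ v ∈ e6PosRoots, ∀ i, e6Reflect i v ∈ e6Roots := by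
  decide +kernel

/-- Every positive root is reached from a simple one by height-increasing simple reflections. -/
theorem exists_e6Reflect_lower : ∀ v ∈ e6PosRoots, (∃ i, v = Pi.single i 1) ∨
    ∃ i, e6Reflect i v ∈ e6PosRoots ∧ ∑ j, e6Reflect i v j < ∑ j, v j := by
  decide +kernel

theorem sum_pos_of_mem_posRoots : ∀ v ∈ e6PosRoots, 0 < ∑ j, v j := by
  decide +kernel

theorem e6Pairing_sub_smul (v w : E6Vec) (n : ℤ) (i : Fin 6) :
    e6Pairing (v - n • w) i = e6Pairing v i - n * e6Pairing w i := by
  simp only [e6Pairing, Pi.sub_apply, Pi.smul_apply, smul_eq_mul, sub_mul, Finset.sum_sub_distrib,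
    Finset.mul_sum, mul_assoc]

theorem e6Reflect_neg (i : Fin 6) (v : E6Vec) : e6Reflect i (-v) = -e6Reflect i v := by
  simp only [e6Reflect, e6Pairing, Pi.neg_apply, neg_mul, Finset.sum_neg_distrib, neg_smul]
  abel

theorem e6Reflect_e6Reflect (i : Fin 6) (v : E6Vec) : e6Reflect i (e6Reflect i v) = v := by
  have h2 : e6Pairing (Pi.single i 1) i = 2 := by revert i; decide
  have : e6Pairing (e6Reflect i v) i = -e6Pairing v i := by
    rw [e6Reflect, e6Pairing_sub_smul, h2]
    ring
  rw [e6Reflect, this, e6Reflect]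
  module

theorem neg_mem_e6Roots {v : E6Vec} (hv : v ∈ e6Roots) : -v ∈ e6Roots := by
  simp only [e6Roots, List.mem_append, List.mem_map] at hv ⊢
  rcases hv with hv | ⟨w, hw, rfl⟩
  · exact Or.inr ⟨v, hv, rfl⟩
  · exact Or.inl (by simpa using hw)

theorem e6Reflect_mem_e6Roots (i : Fin 6) {v : E6Vec} (hv : v ∈ e6Roots) :
    e6Reflect i v ∈ e6Roots := by
  rcases List.mem_append.mp hv with hv | hv
  · exact e6Reflect_mem_of_mem_posRoots v hv i
  · obtain ⟨w, hw, rfl⟩ := List.mem_map.mp hv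
    rw [e6Reflect_neg]
    exact neg_mem_e6Roots (e6Reflect_mem_of_mem_posRoots w hw i)

theorem e6Norm_neg (v : E6Vec) : e6Norm (-v) = e6Norm v := by
  simp [e6Norm, e6Pairing]

theorem e6Norm_eq_two {v : E6Vec} (hv : v ∈ e6Roots) : e6Norm v = 2 := by
  rcases List.mem_append.mp hv with hv | hv
  · exact e6Norm_posRoots v hv
  · obtain ⟨w, hw, rfl⟩ := List.mem_map.mp hv
    rw [e6Norm_neg]
    exact e6Norm_posRoots w hw

theorem zero_notMem_e6Roots : (0 : E6Vec) ∉ e6Roots := fun h ↦ by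
  simpa [e6Norm] using e6Norm_eq_two h

theorem e6Norm_add_add_e6Norm_sub (v w : E6Vec) :
    e6Norm (v + w) + e6Norm (v - w) = 2 * e6Norm v + 2 * e6Norm w := by
  simp only [e6Norm, e6Pairing, Finset.mul_sum, ← Finset.sum_add_distrib, Pi.add_apply,
    Pi.sub_apply]
  exact Finset.sum_congr rfl fun i _ ↦ Finset.sum_congr rfl fun j _ ↦ by ring

/-- In a simply laced root system, `v + w` and `w - v` are not both roots. -/
theorem sub_notMem_e6Roots {v w : E6Vec} (hv : v ∈ e6Roots) (hw : w ∈ e6Roots)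
    (hvw : v + w ∈ e6Roots) : w - v ∉ e6Roots ∧ w - v ≠ 0 := by
  have h := e6Norm_add_add_e6Norm_sub w v
  rw [add_comm w v, e6Norm_eq_two hv, e6Norm_eq_two hw, e6Norm_eq_two hvw] at h
  refine ⟨fun h' ↦ by rw [e6Norm_eq_two h'] at h; lia, fun h' ↦ ?_⟩
  rw [h'] at h
  simp [e6Norm] at h

/-! ### Root spaces of a semisimple Lie algebra -/

section RootSpaces

variable {𝔤 : Type*} [LieRing 𝔤] [LieAlgebra ℂ 𝔤] [FiniteDimensional ℂ 𝔤] [IsKilling ℂ 𝔤]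
  {𝔥 : LieSubalgebra ℂ 𝔤} [𝔥.IsCartanSubalgebra]

theorem exists_smul_of_mem_rootSpace {α : Weight ℂ 𝔥 𝔤} (hα : α.IsNonZero) {x y : 𝔤}
    (hx : x ∈ rootSpace 𝔥 α) (hx0 : x ≠ 0) (hy : y ∈ rootSpace 𝔥 α) : ∃ c : ℂ, y = c • x := by
  have h1 := finrank_rootSpace_eq_one α hα
  obtain ⟨c, hc⟩ := (finrank_eq_one_iff_of_nonzero' (⟨x, hx⟩ : rootSpace 𝔥 α)
    (by simpa [Subtype.ext_iff] using hx0)).mp h1 ⟨y, hy⟩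
  exact ⟨c, by simpa [Subtype.ext_iff] using hc.symm⟩

/-- Root vectors for `α` and `β` have a nonzero bracket if `α + β` is a root and `β - α` is
neither zero nor a root (as always happens in the simply laced case, when `α + β` is a root). This
follows from the Jacobi identity for the `𝔰𝔩₂`-triple of `α`. -/
theorem lie_ne_zero_of_mem_rootSpace {α β : Weight ℂ 𝔥 𝔤} (hα : α.IsNonZero)
    (hadd : rootSpace 𝔥 (α + β : 𝔥 → ℂ) ≠ ⊥) (hsub : rootSpace 𝔥 (β - α : 𝔥 → ℂ) = ⊥)
    {x y : 𝔤} (hx : x ∈ rootSpace 𝔥 α) (hx0 : x ≠ 0) (hy : y ∈ rootSpace 𝔥 β) (hy0 : y ≠ 0) :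
    ⁅x, y⁆ ≠ 0 := by
  obtain ⟨h, e, f, ht, he, hf⟩ := exists_isSl2Triple_of_weight_isNonZero hα
  obtain ⟨c, rfl⟩ := exists_smul_of_mem_rootSpace hα hx hx0 he
  -- The `α`-string through `β` starts at `β` and does not stop there.
  have hc : β (coroot α) ≠ 0 := by
    rw [apply_coroot_eq_cast]
    have h1 := (rootSpace_zsmul_add_ne_bot_iff α β hα 1).mp (by simpa using hadd)
    have h2 : ¬ (1 ≤ (chainBotCoeff α β : ℤ)) := fun h ↦
      (rootSpace_zsmul_add_ne_bot_iff α β hα (-1)).mpr ⟨by lia, by simpa using h⟩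
        (by simpa [neg_add_eq_sub] using hsub)
    exact_mod_cast (by lia : (chainBotCoeff α β : ℤ) - chainTopCoeff α β ≠ 0)
  intro hxy
  have hfy : ⁅f, y⁆ = 0 := by
    have : ⁅f, y⁆ ∈ rootSpace 𝔥 (β - α : 𝔥 → ℂ) := by
      simpa only [neg_add_eq_sub] using lie_mem_genWeightSpace_of_mem_genWeightSpace hf hy
    simpa [hsub] using this
  have hhy : ⁅h, y⁆ = β (coroot α) • y := by
    rw [ht.h_eq_coroot hα he hf, ← lie_eq_smul_of_mem_rootSpace hy]
    rfl
  have : ⁅h, y⁆ = 0 := by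
    rw [← ht.lie_e_f, lie_lie, hfy, smul_lie c x y, hxy]
    simp
  rw [hhy, smul_eq_zero] at this
  tauto

theorem killingForm_ne_zero_of_mem_rootSpace {α : Weight ℂ 𝔥 𝔤} (hα : α.IsNonZero) {x y : 𝔤}
    (hx : x ∈ rootSpace 𝔥 α) (hx0 : x ≠ 0) (hy : y ∈ rootSpace 𝔥 (-α : 𝔥 → ℂ)) (hy0 : y ≠ 0) :
    killingForm ℂ 𝔤 x y ≠ 0 := by
  intro h
  apply hx0
  have : x ∈ LinearMap.ker (killingForm ℂ 𝔤) := by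
    refine mem_ker_killingForm_of_mem_rootSpace_of_forall_rootSpace_neg ℂ 𝔤 𝔥 hx fun z hz ↦ ?_
    obtain ⟨c, rfl⟩ := exists_smul_of_mem_rootSpace (α := -α) (by simpa using hα) hy hy0 hz
    simp [h]
  simpa using this

end RootSpaces

/-! ### Forms of reductive type -/

section ReductiveType

/-- A linear form whose stabilizer is abelian and acts by semisimple endomorphisms is of
reductive type. -/
theorem isOfReductiveType_of_stabilizer {𝔞 : Type*} [LieRing 𝔞] [LieAlgebra ℂ 𝔞]
    (f : Module.Dual ℂ 𝔞)
    (hcomm : ∀ x ∈ coadjointStabilizer f, ∀ y ∈ coadjointStabilizer f, ⁅x, y⁆ = 0)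
    (hss : ∀ x ∈ coadjointStabilizer f, (LieAlgebra.ad ℂ 𝔞 x).IsSemisimple) :
    IsOfReductiveType f := by
  refine ⟨?_, fun x _ ↦ hss x x.2⟩
  refine LieAlgebra.hasCentralRadical_of_radical_le ℂ _ fun x _ ↦ ?_
  rw [LieModule.mem_maxTrivSubmodule]
  intro y
  obtain ⟨x, rfl⟩ := LieSubmodule.Quotient.surjective_mk' _ x
  obtain ⟨y, rfl⟩ := LieSubmodule.Quotient.surjective_mk' _ y
  have : ⁅y, x⁆ = 0 := Subtype.ext (hcomm y y.2 x x.2)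
  have h2 : LieSubmodule.Quotient.mk' (centerInStabilizer f) ⁅y, x⁆ = 0 := by rw [this]; simp
  exact h2

/-- If the stabilizer in a subalgebra `𝔞` of `𝔤` of a linear form on `𝔞` lies in a Cartan
subalgebra of `𝔤`, then the form is of reductive type. -/
theorem isOfReductiveType_of_stabilizer_le_cartan {𝔤 : Type*} [LieRing 𝔤] [LieAlgebra ℂ 𝔤]
    [FiniteDimensional ℂ 𝔤] [LieAlgebra.IsKilling ℂ 𝔤] (𝔥 : LieSubalgebra ℂ 𝔤)
    [𝔥.IsCartanSubalgebra] (𝔞 : LieSubalgebra ℂ 𝔤) (f : Module.Dual ℂ 𝔞)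
    (h : ∀ x ∈ coadjointStabilizer f, (x : 𝔤) ∈ 𝔥) : IsOfReductiveType f := by
  refine isOfReductiveType_of_stabilizer f (fun x hx y hy ↦ ?_) fun x hx ↦ ?_
  · have := trivial_lie_zero 𝔥 𝔥 ⟨x, h x hx⟩ ⟨y, h y hy⟩
    exact Subtype.ext (congrArg (fun z : 𝔥 ↦ (z : 𝔤)) this)
  · have hs := isSemisimple_ad_of_mem_isCartanSubalgebra (h x hx)
    have hp : 𝔞.toSubmodule ∈ (LieAlgebra.ad ℂ 𝔤 (x : 𝔤)).invtSubmodule := by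
      intro y hy
      exact 𝔞.lie_mem x.2 hy
    exact hs.restrict hp

end ReductiveType

/-! ### Weight spaces in coordinates -/

section Coordinates

variable {𝔤 : Type*} [LieRing 𝔤] [LieAlgebra ℂ 𝔤] [FiniteDimensional ℂ 𝔤] [IsKilling ℂ 𝔤]
  {𝔥 : LieSubalgebra ℂ 𝔤} [𝔥.IsCartanSubalgebra] {b : (rootSystem 𝔥).Base}

/-- The linear form `∑ vᵢ αᵢ` on the Cartan subalgebra, where `αᵢ` are the simple roots. -/
noncomputable def e6Weight (e : Fin 6 ≃ b.support) (v : E6Vec) : Module.Dual ℂ 𝔥 :=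
  ∑ i, v i • (rootSystem 𝔥).root (e i)

/-- The weight space of `𝔤` for the weight `∑ vᵢ αᵢ`; it is zero unless `v` is zero or the
coordinate vector of a root. -/
noncomputable def e6Space (e : Fin 6 ≃ b.support) (v : E6Vec) : Submodule ℂ 𝔤 :=
  (rootSpace 𝔥 (e6Weight e v : 𝔥 → ℂ)).toSubmodule

variable (e : Fin 6 ≃ b.support)

theorem e6Weight_add (v w : E6Vec) : e6Weight e (v + w) = e6Weight e v + e6Weight e w := by
  simp [e6Weight, add_smul, Finset.sum_add_distrib]

theorem e6Weight_neg (v : E6Vec) : e6Weight e (-v) = -e6Weight e v := by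
  simp [e6Weight]

theorem e6Weight_zero : e6Weight e 0 = 0 := by
  simp [e6Weight]

theorem e6Weight_sub (v w : E6Vec) : e6Weight e (v - w) = e6Weight e v - e6Weight e w := by
  rw [sub_eq_add_neg, e6Weight_add, e6Weight_neg, sub_eq_add_neg]

theorem e6Weight_zsmul (n : ℤ) (v : E6Vec) : e6Weight e (n • v) = n • e6Weight e v := by
  simp [e6Weight, mul_smul, Finset.smul_sum]

theorem e6Weight_single (i : Fin 6) :
    e6Weight e (Pi.single i 1) = (rootSystem 𝔥).root (e i) := by
  rw [e6Weight, Finset.sum_eq_single i (fun j _ hj ↦ by simp [hj]) (by simp)]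
  simp

theorem e6_linearIndependent :
    LinearIndependent ℂ fun i ↦ (rootSystem 𝔥).root (e i) :=
  b.linearIndepOn_root.linearIndependent.comp e e.injective

theorem e6Weight_injective : Function.Injective (e6Weight e) := by
  intro v w h
  have hli := (e6_linearIndependent e).restrict_scalars' ℤ
  exact funext (Fintype.linearIndependent_iffₛ.mp hli v w h)

theorem e6Weight_eq_zero_iff {v : E6Vec} : e6Weight e v = 0 ↔ v = 0 := by
  rw [← e6Weight_zero e, (e6Weight_injective e).eq_iff]

/-- There is an element of the Cartan subalgebra on which the simple roots take given values. -/
theorem exists_forall_e6Weight_eq (d : E6Vec) :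
    ∃ h : 𝔥, ∀ v, e6Weight e v h = ((∑ i, v i * d i : ℤ) : ℂ) := by
  classical
  let B := b.toWeightBasis.reindex e.symm
  obtain ⟨h, hh⟩ := (Module.evalEquiv ℂ 𝔥).surjective (B.constr ℂ fun i ↦ (d i : ℂ))
  refine ⟨h, fun v ↦ ?_⟩
  have key (i : Fin 6) : (rootSystem 𝔥).root (e i) h = d i := by
    have h1 := LinearMap.congr_fun hh (B i)
    rw [Module.Basis.constr_basis, Module.evalEquiv_apply, Module.Dual.eval_apply] at h1
    simpa [B] using h1
  simp only [e6Weight, LinearMap.sum_apply, LinearMap.smul_apply, key]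
  simp

theorem mem_e6Space_zero {x : 𝔤} : x ∈ e6Space e 0 ↔ x ∈ 𝔥 := by
  rw [e6Space, e6Weight_zero]
  change x ∈ rootSpace 𝔥 (0 : 𝔥 → ℂ) ↔ _
  rw [rootSpace_zero_eq]
  rfl

theorem lie_mem_e6Space {v w : E6Vec} {x y : 𝔤} (hx : x ∈ e6Space e v) (hy : y ∈ e6Space e w) :
    ⁅x, y⁆ ∈ e6Space e (v + w) := by
  rw [e6Space, e6Weight_add]
  exact lie_mem_genWeightSpace_of_mem_genWeightSpace hx hy

theorem lie_eq_e6Weight_smul {v : E6Vec} {x : 𝔤} (hx : x ∈ e6Space e v) (h : 𝔥) :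
    ⁅(h : 𝔤), x⁆ = e6Weight e v h • x :=
  lie_eq_smul_of_mem_rootSpace hx h

theorem killingForm_eq_zero_of_mem_e6Space {v w : E6Vec} (h : v + w ≠ 0) {x y : 𝔤}
    (hx : x ∈ e6Space e v) (hy : y ∈ e6Space e w) : killingForm ℂ 𝔤 x y = 0 := by
  refine killingForm_apply_eq_zero_of_mem_rootSpace_of_add_ne_zero ℂ 𝔤 𝔥 hx hy fun h0 ↦ h ?_
  rw [← e6Weight_eq_zero_iff e, e6Weight_add]
  exact LinearMap.ext fun z ↦ congrFun h0 z

variable (he : ∀ i j : Fin 6, b.cartanMatrix (e i) (e j) = CartanMatrix.E₆ i j)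
include he

theorem root_reflectionPerm_eq_e6Weight (j : Fin 6) {α : 𝔥.root} {v : E6Vec}
    (h : (rootSystem 𝔥).root α = e6Weight e v) :
    (rootSystem 𝔥).root ((rootSystem 𝔥).reflectionPerm (e j) α) = e6Weight e (e6Reflect j v) := by
  rw [RootPairing.root_reflectionPerm, RootPairing.reflection_apply, h, e6Reflect, e6Weight_sub,
    e6Weight_zsmul, e6Weight_single]
  congr 1
  have key (i : Fin 6) : (rootSystem 𝔥).coroot' (e j) ((rootSystem 𝔥).root (e i)) =
      (CartanMatrix.E₆ i j : ℂ) := by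
    rw [← he i j, RootPairing.root_coroot'_eq_pairing,
      ← RootPairing.Base.algebraMap_cartanMatrixIn_apply (S := ℤ)]
    rfl
  have : (rootSystem 𝔥).coroot' (e j) (e6Weight e v) = (e6Pairing v j : ℂ) := by
    rw [e6Weight, map_sum, e6Pairing]
    simp only [map_zsmul, key]
    simp
  rw [this, Int.cast_smul_eq_zsmul]

/-- Every root of `𝔤` has its coordinates in `e6Roots`: this list contains the simple roots and is
stable under negation and the simple reflections. -/
theorem exists_mem_e6Roots (α : 𝔥.root) :
    ∃ v ∈ e6Roots, (rootSystem 𝔥).root α = e6Weight e v := by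
  refine RootPairing.Base.induction_reflect (b := b) α
    (p := fun α ↦ ∃ v ∈ e6Roots, (rootSystem 𝔥).root α = e6Weight e v) ?_ ?_ ?_
  · rintro i ⟨v, hv, hi⟩
    exact ⟨-v, neg_mem_e6Roots hv, by rw [RootPairing.root_reflectionPerm,
      RootPairing.reflection_apply_self, hi, e6Weight_neg]⟩
  · intro i hi
    obtain ⟨j, hj⟩ := e.surjective ⟨i, hi⟩
    refine ⟨Pi.single j 1, List.mem_append_left _ (single_mem_e6PosRoots j), ?_⟩
    rw [e6Weight_single, hj]
  · rintro i k ⟨v, hv, hi⟩ hk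
    obtain ⟨j, hj⟩ := e.surjective ⟨k, hk⟩
    refine ⟨e6Reflect j v, e6Reflect_mem_e6Roots j hv, ?_⟩
    rw [← root_reflectionPerm_eq_e6Weight e he j hi, hj]

/-- Every vector in `e6PosRoots` is the coordinate vector of a root of `𝔤`. -/
theorem exists_root_of_mem_posRoots {v : E6Vec} (hv : v ∈ e6PosRoots) :
    ∃ α, (rootSystem 𝔥).root α = e6Weight e v := by
  generalize hN : (∑ j, v j).toNat = N
  induction N using Nat.strongRecOn generalizing v with
  | ind N ih =>
    rcases exists_e6Reflect_lower v hv with ⟨i, rfl⟩ | ⟨i, hi, hlt⟩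
    · exact ⟨e i, (e6Weight_single e i).symm⟩
    · have hpos := sum_pos_of_mem_posRoots v hv
      obtain ⟨α, hα⟩ := ih _ (by lia) hi rfl
      refine ⟨_, (root_reflectionPerm_eq_e6Weight e he i hα).trans ?_⟩
      rw [e6Reflect_e6Reflect]

theorem exists_root_of_mem_e6Roots {v : E6Vec} (hv : v ∈ e6Roots) :
    ∃ α : 𝔥.root, (rootSystem 𝔥).root α = e6Weight e v := by
  rcases List.mem_append.mp hv with hv | hv
  · exact exists_root_of_mem_posRoots e he hv
  · obtain ⟨w, hw, rfl⟩ := List.mem_map.mp hv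
    obtain ⟨α, hα⟩ := exists_root_of_mem_posRoots e he hw
    refine ⟨(rootSystem 𝔥).reflectionPerm α α, ?_⟩
    rw [RootPairing.root_reflectionPerm, RootPairing.reflection_apply_self, hα, e6Weight_neg]

theorem exists_weight_of_mem_e6Roots {v : E6Vec} (hv : v ∈ e6Roots) :
    ∃ α : Weight ℂ 𝔥 𝔤, α.IsNonZero ∧ (α : 𝔥 → ℂ) = e6Weight e v := by
  obtain ⟨α, hα⟩ := exists_root_of_mem_e6Roots e he hv
  exact ⟨α, LieSubalgebra.isNonZero_coe_root α, by rw [← hα]; rfl⟩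

theorem e6Space_eq_bot {v : E6Vec} (hv : v ∉ e6Roots) (h0 : v ≠ 0) : e6Space (𝔤 := 𝔤) e v = ⊥ := by
  by_contra hne
  have hne' : rootSpace 𝔥 (e6Weight e v : 𝔥 → ℂ) ≠ ⊥ := by
    simpa [e6Space] using hne
  let α : Weight ℂ 𝔥 𝔤 := ⟨e6Weight e v, hne'⟩
  have hα : α.IsNonZero := by
    intro h
    apply h0
    rw [← e6Weight_eq_zero_iff e]
    exact LinearMap.ext fun z ↦ congrFun h z
  obtain ⟨w, hw, hαw⟩ := exists_mem_e6Roots e he ⟨α, by simpa using hα⟩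
  have : v = w := e6Weight_injective e (by rw [← hαw]; rfl)
  exact hv (this ▸ hw)

theorem exists_ne_zero_mem_e6Space {v : E6Vec} (hv : v ∈ e6Roots) :
    ∃ x ∈ e6Space (𝔤 := 𝔤) e v, x ≠ 0 := by
  obtain ⟨α, -, h⟩ := exists_weight_of_mem_e6Roots e he hv
  obtain ⟨x, hx, hx0⟩ := α.exists_ne_zero
  exact ⟨x, by rw [e6Space, ← h]; exact hx, hx0⟩

theorem exists_smul_of_mem_e6Space {v : E6Vec} (hv : v ∈ e6Roots) {x y : 𝔤}
    (hx : x ∈ e6Space e v) (hx0 : x ≠ 0) (hy : y ∈ e6Space e v) : ∃ c : ℂ, y = c • x := by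
  obtain ⟨α, hα, h⟩ := exists_weight_of_mem_e6Roots e he hv
  rw [e6Space, ← h] at hx hy
  exact exists_smul_of_mem_rootSpace hα hx hx0 hy

theorem lie_ne_zero_of_mem_e6Space {v w : E6Vec} (hv : v ∈ e6Roots) (hw : w ∈ e6Roots)
    (hvw : v + w ∈ e6Roots) {x y : 𝔤} (hx : x ∈ e6Space e v) (hx0 : x ≠ 0)
    (hy : y ∈ e6Space e w) (hy0 : y ≠ 0) : ⁅x, y⁆ ≠ 0 := by
  obtain ⟨α, hα, h⟩ := exists_weight_of_mem_e6Roots e he hv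
  obtain ⟨β, -, h'⟩ := exists_weight_of_mem_e6Roots e he hw
  obtain ⟨z, hz, hz0⟩ := exists_ne_zero_mem_e6Space e he hvw
  obtain ⟨hd, hd0⟩ := sub_notMem_e6Roots hv hw hvw
  have hbot := e6Space_eq_bot (𝔤 := 𝔤) e he hd hd0
  rw [e6Space, ← h] at hx
  rw [e6Space, ← h'] at hy
  rw [e6Space, e6Weight_add] at hz
  rw [e6Space, e6Weight_sub] at hbot
  refine lie_ne_zero_of_mem_rootSpace hα ?_ ?_ hx hx0 hy hy0
  · intro hb
    rw [h, h'] at hb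
    have : z ∈ rootSpace 𝔥 (e6Weight e v + e6Weight e w : 𝔥 → ℂ) := hz
    rw [hb] at this
    exact hz0 (by simpa using this)
  · rw [h, h', ← LieSubmodule.toSubmodule_eq_bot]
    exact hbot

theorem killingForm_ne_zero_of_mem_e6Space {v : E6Vec} (hv : v ∈ e6Roots) {x y : 𝔤}
    (hx : x ∈ e6Space e v) (hx0 : x ≠ 0) (hy : y ∈ e6Space e (-v)) (hy0 : y ≠ 0) :
    killingForm ℂ 𝔤 x y ≠ 0 := by
  obtain ⟨α, hα, h⟩ := exists_weight_of_mem_e6Roots e he hv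
  rw [e6Space, ← h] at hx
  rw [e6Space, e6Weight_neg] at hy
  refine killingForm_ne_zero_of_mem_rootSpace hα hx hx0 ?_ hy0
  rw [h]
  exact hy

end Coordinates

/-! ### The standard parabolic subalgebras -/

theorem nonneg_of_mem_e6PosRoots : ∀ v ∈ e6PosRoots, ∀ i, 0 ≤ v i := by
  decide +kernel

/-- The roots of the standard parabolic subalgebra attached to a set `J` of simple roots: those
whose coordinates outside `J` are nonnegative. -/
def e6ParabolicRoots (J : Finset (Fin 6)) : Finset E6Vec :=
  {v ∈ e6Roots.toFinset | ∀ i ∉ J, 0 ≤ v i}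

theorem mem_e6ParabolicRoots {J : Finset (Fin 6)} {v : E6Vec} :
    v ∈ e6ParabolicRoots J ↔ v ∈ e6Roots ∧ ∀ i ∉ J, 0 ≤ v i := by
  simp [e6ParabolicRoots]

section Parabolic

variable {𝔤 : Type*} [LieRing 𝔤] [LieAlgebra ℂ 𝔤] [FiniteDimensional ℂ 𝔤] [IsKilling ℂ 𝔤]
  {𝔥 : LieSubalgebra ℂ 𝔤} [𝔥.IsCartanSubalgebra] {b : (rootSystem 𝔥).Base}
  (e : Fin 6 ≃ b.support)

theorem height_eq_sum_of_root_eq_e6Weight {α : 𝔥.root} {v : E6Vec}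
    (h : (rootSystem 𝔥).root α = e6Weight e v) : b.height α = ∑ i, v i := by
  classical
  let f : 𝔥.root → ℤ := fun β ↦ if hβ : β ∈ b.support then v (e.symm ⟨β, hβ⟩) else 0
  have hf (i : Fin 6) : f (e i) = v i := by simp [f]
  rw [RootPairing.Base.height_eq_sum (f := f), ← Finset.sum_coe_sort, ← Equiv.sum_comp e]
  · simp only [hf]
  · rw [h, ← Finset.sum_coe_sort, ← Equiv.sum_comp e, e6Weight]
    simp only [hf]

theorem lie_mem_iSup_e6Space (T : Set E6Vec) (hT : ∀ v ∈ T, ∀ w ∈ T, v + w ∈ T) {x y : 𝔤}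
    (hx : x ∈ ⨆ v ∈ T, e6Space (𝔤 := 𝔤) e v) (hy : y ∈ ⨆ v ∈ T, e6Space (𝔤 := 𝔤) e v) :
    ⁅x, y⁆ ∈ ⨆ v ∈ T, e6Space (𝔤 := 𝔤) e v := by
  rw [iSup_subtype'] at hx hy
  induction hx using Submodule.iSup_induction' with
  | zero => simp
  | add x x' _ _ h h' => rw [add_lie]; exact add_mem h h'
  | mem v x hx =>
    induction hy using Submodule.iSup_induction' with
    | zero => simp
    | add y y' _ _ h h' => rw [lie_add]; exact add_mem h h'
    | mem w y hy =>
      exact Submodule.mem_iSup_of_mem (v + w : E6Vec)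
        (Submodule.mem_iSup_of_mem (hT v v.2 w w.2) (lie_mem_e6Space e hx hy))

variable (he : ∀ i j : Fin 6, b.cartanMatrix (e i) (e j) = CartanMatrix.E₆ i j)
include he

theorem mem_e6PosRoots_of_isPos {α : 𝔥.root} (hα : b.IsPos α) :
    ∃ v ∈ e6PosRoots, (rootSystem 𝔥).root α = e6Weight e v := by
  obtain ⟨v, hv, h⟩ := exists_mem_e6Roots e he α
  refine ⟨v, ?_, h⟩
  rcases List.mem_append.mp hv with hv | hv
  · exact hv
  · obtain ⟨w, hw, rfl⟩ := List.mem_map.mp hv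
    rw [RootPairing.Base.isPos_iff, height_eq_sum_of_root_eq_e6Weight e h] at hα
    have := sum_pos_of_mem_posRoots w hw
    simp only [Pi.neg_apply, Finset.sum_neg_distrib] at hα
    lia

theorem e6Space_le_standardParabolic_of_mem_posRoots (π' : Set b.support) {v : E6Vec}
    (hv : v ∈ e6PosRoots) : e6Space e v ≤ (standardParabolic 𝔥 b π').toSubmodule := by
  obtain ⟨α, hα⟩ := exists_root_of_mem_posRoots e he hv
  intro x hx
  refine LieSubalgebra.subset_lieSpan (Or.inl (Or.inr (Set.mem_iUnion.mpr ⟨⟨α, ?_⟩, ?_⟩)))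
  · rw [RootPairing.Base.isPos_iff, height_eq_sum_of_root_eq_e6Weight e hα]
    exact sum_pos_of_mem_posRoots v hv
  · have : (α.1 : 𝔥 → ℂ) = e6Weight e v := by rw [← hα]; rfl
    change x ∈ rootSpace 𝔥 (α.1 : 𝔥 → ℂ)
    rw [this]
    exact hx

omit he in
theorem e6Space_neg_single_le_standardParabolic (J : Finset (Fin 6)) {j : Fin 6} (hj : j ∈ J) :
    e6Space e (-Pi.single j 1) ≤
      (standardParabolic 𝔥 b ((fun i ↦ e i) '' (J : Set (Fin 6)))).toSubmodule := by
  intro x hx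
  refine LieSubalgebra.subset_lieSpan (Or.inr ?_)
  refine Set.mem_iUnion₂.mpr ⟨e j, ⟨j, hj, rfl⟩, ?_⟩
  rw [e6Space, e6Weight_neg, e6Weight_single] at hx
  exact hx

/-- The standard parabolic subalgebra contains the root spaces of all the roots in
`e6ParabolicRoots J`, if the negative ones among these are negatives of simple roots or of sums of
two simple roots: the root spaces of the latter are brackets of generators. -/
theorem e6Space_le_standardParabolic (J : Finset (Fin 6))
    (hJ : ∀ v ∈ e6ParabolicRoots J, v ∈ e6PosRoots ∨ (∃ j ∈ J, v = -Pi.single j 1) ∨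
      ∃ i ∈ J, ∃ j ∈ J, v = -Pi.single i 1 + -Pi.single j 1)
    {v : E6Vec} (hv : v ∈ e6ParabolicRoots J) :
    e6Space e v ≤ (standardParabolic 𝔥 b ((fun i ↦ e i) '' (J : Set (Fin 6)))).toSubmodule := by
  rcases hJ v hv with hp | ⟨j, hj, rfl⟩ | ⟨i, hi, j, hj, rfl⟩
  · exact e6Space_le_standardParabolic_of_mem_posRoots e he _ hp
  · exact e6Space_neg_single_le_standardParabolic e J hj
  · intro z hz
    have hr (i : Fin 6) : -Pi.single i 1 ∈ e6Roots :=
      neg_mem_e6Roots (List.mem_append_left _ (single_mem_e6PosRoots i))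
    obtain ⟨x, hx, hx0⟩ := exists_ne_zero_mem_e6Space (𝔤 := 𝔤) e he (hr i)
    obtain ⟨y, hy, hy0⟩ := exists_ne_zero_mem_e6Space (𝔤 := 𝔤) e he (hr j)
    have hij := (mem_e6ParabolicRoots.mp hv).1
    obtain ⟨c, rfl⟩ := exists_smul_of_mem_e6Space e he hij (lie_mem_e6Space e hx hy)
      (lie_ne_zero_of_mem_e6Space e he (hr i) (hr j) hij hx hx0 hy hy0) hz
    exact (standardParabolic 𝔥 b _).smul_mem c ((standardParabolic 𝔥 b _).lie_mem
      (e6Space_neg_single_le_standardParabolic e J hi hx)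
      (e6Space_neg_single_le_standardParabolic e J hj hy))

theorem standardParabolic_le_iSup_e6Space (J : Finset (Fin 6)) {x : 𝔤}
    (hx : x ∈ standardParabolic 𝔥 b ((fun i ↦ e i) '' (J : Set (Fin 6)))) :
    x ∈ ⨆ v ∈ {v : E6Vec | ∀ i ∉ J, 0 ≤ v i}, e6Space (𝔤 := 𝔤) e v := by
  have hmem {v : E6Vec} (hv : ∀ i ∉ J, 0 ≤ v i) {x : 𝔤} (hx : x ∈ e6Space e v) :
      x ∈ ⨆ v ∈ {v : E6Vec | ∀ i ∉ J, 0 ≤ v i}, e6Space (𝔤 := 𝔤) e v :=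
    Submodule.mem_iSup_of_mem v (Submodule.mem_iSup_of_mem hv hx)
  induction hx using LieSubalgebra.lieSpan_induction with
  | zero => exact zero_mem _
  | add _ _ _ _ h h' => exact add_mem h h'
  | smul c _ _ h => exact Submodule.smul_mem _ c h
  | lie x y _ _ h h' =>
    exact lie_mem_iSup_e6Space e {v : E6Vec | ∀ i ∉ J, 0 ≤ v i}
      (fun v hv w hw i hi ↦ add_nonneg (hv i hi) (hw i hi)) h h'
  | mem x hx =>
    rcases hx with (hx | hx) | hx
    · exact hmem (v := 0) (fun i _ ↦ le_rfl) ((mem_e6Space_zero e).mpr hx)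
    · obtain ⟨⟨α, hα⟩, hx⟩ := Set.mem_iUnion.mp hx
      obtain ⟨v, hv, h⟩ := mem_e6PosRoots_of_isPos e he hα
      refine hmem (v := v) (fun i _ ↦ nonneg_of_mem_e6PosRoots v hv i) ?_
      rw [e6Space, ← h]
      exact hx
    · obtain ⟨α, ⟨j, hj, rfl⟩, hx⟩ := Set.mem_iUnion₂.mp hx
      refine hmem (v := -Pi.single j 1) (fun i hi ↦ ?_) ?_
      · have : i ≠ j := fun h ↦ hi (h ▸ hj)
        simp [this]
      · rw [e6Space, e6Weight_neg, e6Weight_single]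
        exact hx

/-- The decomposition of an element of a standard parabolic subalgebra into its Cartan component and
its root components. -/
theorem exists_eq_add_sum_of_mem_standardParabolic (J : Finset (Fin 6)) {x : 𝔤}
    (hx : x ∈ standardParabolic 𝔥 b ((fun i ↦ e i) '' (J : Set (Fin 6)))) :
    ∃ h : 𝔥, ∃ y : E6Vec → 𝔤, (∀ v, y v ∈ e6Space e v) ∧
      x = h + ∑ v ∈ e6ParabolicRoots J, y v := by
  have h0 : (0 : E6Vec) ∉ e6ParabolicRoots J := fun h ↦
    zero_notMem_e6Roots (mem_e6ParabolicRoots.mp h).1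
  have hle : ⨆ v ∈ {v : E6Vec | ∀ i ∉ J, 0 ≤ v i}, e6Space (𝔤 := 𝔤) e v ≤
      ⨆ v ∈ insert 0 (e6ParabolicRoots J), e6Space (𝔤 := 𝔤) e v := by
    refine iSup₂_le fun v hv ↦ ?_
    by_cases hv' : v ∈ insert 0 (e6ParabolicRoots J)
    · exact le_iSup₂_of_le v hv' le_rfl
    · rw [Finset.mem_insert, not_or, mem_e6ParabolicRoots] at hv'
      rw [e6Space_eq_bot e he (fun h ↦ hv'.2 ⟨h, hv⟩) hv'.1]
      exact bot_le
  obtain ⟨μ, hμ⟩ := (Submodule.mem_iSup_finset_iff_exists_sum _ _).mp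
    (hle (standardParabolic_le_iSup_e6Space e he J hx))
  rw [Finset.sum_insert h0] at hμ
  exact ⟨⟨μ 0, (mem_e6Space_zero e).mp (μ 0).2⟩, fun v ↦ μ v, fun v ↦ (μ v).2, hμ.symm⟩

end Parabolic

/-! ### The linear forms -/

section Forms

variable {𝔤 : Type*} [LieRing 𝔤] [LieAlgebra ℂ 𝔤] [FiniteDimensional ℂ 𝔤] [IsKilling ℂ 𝔤]
  {𝔥 : LieSubalgebra ℂ 𝔤} [𝔥.IsCartanSubalgebra] {b : (rootSystem 𝔥).Base}

/-- A linear form `φ` on `𝔤` supported on the root spaces of the roots in `S`, and on the Cartan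
subalgebra, where it is Killing dual to an element on which the simple roots take the values
`d`; the last clause records the latter through the brackets of opposite root vectors. -/
structure IsE6Form (e : Fin 6 ≃ b.support) (S : Finset E6Vec) (d : E6Vec)
    (φ : Module.Dual ℂ 𝔤) : Prop where
  eq_zero : ∀ v, v ≠ 0 → v ∉ S → ∀ x ∈ e6Space e v, φ x = 0
  ne_zero : ∀ v ∈ S, ∀ x ∈ e6Space e v, x ≠ 0 → φ x ≠ 0
  lie_neg : ∀ v, ∀ x ∈ e6Space e v, ∀ y ∈ e6Space e (-v),
    φ ⁅x, y⁆ = ((∑ i, v i * d i : ℤ) : ℂ) * killingForm ℂ 𝔤 x y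

/-- The graph of the pairing `(x, y) ↦ φ ⁅x, y⁆` on root vectors, for a form `φ` as in
`IsE6Form`. -/
abbrev E6Adj (S : Finset E6Vec) (d u w : E6Vec) : Prop :=
  u + w ∈ S ∨ (u + w = 0 ∧ ∑ i, u i * d i ≠ 0)

variable (e : Fin 6 ≃ b.support)
  (he : ∀ i j : Fin 6, b.cartanMatrix (e i) (e j) = CartanMatrix.E₆ i j)
include he

/-- Existence of the forms of `IsE6Form`: take the Killing dual of `h₀ + ∑ u_s`, where `u_s` is a
root vector for `-s` and `αᵢ(h₀) = dᵢ`. -/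
theorem exists_isE6Form (S : Finset E6Vec) (hS : ∀ s ∈ S, s ∈ e6Roots) (d : E6Vec) :
    ∃ φ : Module.Dual ℂ 𝔤, IsE6Form e S d φ := by
  classical
  obtain ⟨h₀, hd⟩ := exists_forall_e6Weight_eq e d
  have hu (s : E6Vec) : ∃ u ∈ e6Space (𝔤 := 𝔤) e (-s), s ∈ S → u ≠ 0 := by
    by_cases hs : s ∈ S
    · obtain ⟨u, hu, hu0⟩ := exists_ne_zero_mem_e6Space (𝔤 := 𝔤) e he (neg_mem_e6Roots (hS s hs))
      exact ⟨u, hu, fun _ ↦ hu0⟩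
    · exact ⟨0, zero_mem _, fun h ↦ absurd h hs⟩
  choose u hu hu0 using hu
  have hh₀ : (h₀ : 𝔤) ∈ e6Space e 0 := (mem_e6Space_zero e).mpr h₀.2
  have hS0 : (0 : E6Vec) ∉ S := fun h ↦ zero_notMem_e6Roots (hS 0 h)
  refine ⟨killingForm ℂ 𝔤 (h₀ + ∑ s ∈ S, u s), ⟨fun v hv0 hv x hx ↦ ?_, fun v hv x hx hx0 ↦ ?_,
    fun v x hx y hy ↦ ?_⟩⟩
  · rw [map_add, map_sum, LinearMap.add_apply, LinearMap.sum_apply,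
      killingForm_eq_zero_of_mem_e6Space e (by simpa using hv0) hh₀ hx, zero_add]
    refine Finset.sum_eq_zero fun s hs ↦ killingForm_eq_zero_of_mem_e6Space e ?_ (hu s) hx
    rw [neg_add_eq_sub, sub_ne_zero]
    rintro rfl
    exact hv hs
  · have hv0 : v ≠ 0 := fun h ↦ hS0 (h ▸ hv)
    rw [map_add, map_sum, LinearMap.add_apply, LinearMap.sum_apply,
      killingForm_eq_zero_of_mem_e6Space e (by simpa using hv0) hh₀ hx, zero_add,
      Finset.sum_eq_single v]
    · refine killingForm_ne_zero_of_mem_e6Space e he (neg_mem_e6Roots (hS v hv)) (hu v)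
        (hu0 v hv) (by rwa [neg_neg]) hx0
    · intro s hs hsv
      refine killingForm_eq_zero_of_mem_e6Space e ?_ (hu s) hx
      rw [neg_add_eq_sub, sub_ne_zero]
      exact hsv.symm
    · exact fun h ↦ absurd hv h
  · have hxy : ⁅x, y⁆ ∈ e6Space e 0 := by
      simpa using lie_mem_e6Space e hx hy
    -- Only `h₀` contributes, and `κ(h₀, ⁅x, y⁆) = κ(⁅h₀, x⁆, y)` by invariance.
    rw [map_add, map_sum, LinearMap.add_apply, LinearMap.sum_apply,
      Finset.sum_eq_zero fun s hs ↦ killingForm_eq_zero_of_mem_e6Space e ?_ (hu s) hxy, add_zero,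
      ← hd, ← LieModule.traceForm_apply_lie_apply, lie_eq_e6Weight_smul e hx h₀, map_smul]
    · rfl
    · rw [add_zero, neg_ne_zero]
      exact fun h ↦ hS0 (h ▸ hs)

variable {e} {S : Finset E6Vec} {d : E6Vec} {φ : Module.Dual ℂ 𝔤} (hφ : IsE6Form e S d φ)
include hφ

omit he in
theorem IsE6Form.lie_eq_zero {v w : E6Vec} (h : ¬ E6Adj S d v w) {x y : 𝔤}
    (hx : x ∈ e6Space e v) (hy : y ∈ e6Space e w) : φ ⁅x, y⁆ = 0 := by
  rw [not_or, not_and, not_not] at h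
  by_cases h0 : v + w = 0
  · rw [hφ.lie_neg v x hx y (by rwa [← eq_neg_of_add_eq_zero_right h0]), h.2 h0]
    simp
  · exact hφ.eq_zero _ h0 h.1 _ (lie_mem_e6Space e hx hy)

theorem IsE6Form.lie_ne_zero (hS : ∀ s ∈ S, s ∈ e6Roots) {v w : E6Vec} (h : E6Adj S d v w)
    (hv : v ∈ e6Roots) (hw : w ∈ e6Roots) {x y : 𝔤} (hx : x ∈ e6Space e v) (hx0 : x ≠ 0)
    (hy : y ∈ e6Space e w) (hy0 : y ≠ 0) : φ ⁅x, y⁆ ≠ 0 := by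
  rcases h with h | ⟨h, hd⟩
  · exact hφ.ne_zero _ h _ (lie_mem_e6Space e hx hy)
      (lie_ne_zero_of_mem_e6Space e he hv hw (hS _ h) hx hx0 hy hy0)
  · have hy' : y ∈ e6Space e (-v) := by rwa [← eq_neg_of_add_eq_zero_right h]
    rw [hφ.lie_neg v x hx y hy']
    exact mul_ne_zero (by exact_mod_cast hd)
      (killingForm_ne_zero_of_mem_e6Space e he hv hx hx0 hy' hy0)

end Forms

/-! ### Elimination -/

section Elimination

/-- A symmetric `3 × 3` matrix with zero diagonal and nonzero entries `x, y, z` off the diagonal has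
determinant `2xyz`, so it is invertible. -/
theorem eq_zero_of_symm_offDiag {m : Fin 3 → Fin 3 → ℂ} (hm : ∀ i j, i ≠ j → m i j = m j i)
    (hm0 : ∀ i j, i ≠ j → m i j ≠ 0) {c : Fin 3 → ℂ}
    (hc : ∀ i, ∑ j ∈ {j | j ≠ i}, c j * m i j = 0) : ∀ i, c i = 0 := by
  have h0 := hc 0
  have h1 := hc 1
  have h2 := hc 2
  simp only [Finset.sum_filter, Fin.sum_univ_three] at h0 h1 h2
  simp at h0 h1 h2
  rw [hm 1 0 (by decide)] at h1
  rw [hm 2 0 (by decide), hm 2 1 (by decide)] at h2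
  have m01 := hm0 0 1 (by decide)
  have m02 := hm0 0 2 (by decide)
  have m12 := hm0 1 2 (by decide)
  have c0 : c 0 = 0 := by
    have : 2 * (m 0 1 * m 0 2) * c 0 = 0 := by
      linear_combination m 0 2 * h1 + m 0 1 * h2 - m 1 2 * h0
    simpa [m01, m02] using this
  rw [c0] at h1 h2
  simp [m12] at h1 h2
  intro i
  fin_cases i
  · exact c0
  · exact h2
  · exact h1

/-- One round of elimination on the equations `φ ⁅∑ y u, z⁆ = 0`, where `y u` lies in the root
space of `u ∈ L`: if the components in `Z` vanish, then so does that of every `v` for which some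
`w` is adjacent to `v` and to no other element of `L` outside `Z`. -/
def e6Eliminate (L S : Finset E6Vec) (d : E6Vec) (Z : Finset E6Vec) : Finset E6Vec :=
  {v ∈ L | v ∈ Z ∨ ∃ w ∈ L, w ∉ S ∧ E6Adj S d v w ∧
    ∀ u ∈ L, E6Adj S d u w → u = v ∨ u ∈ Z}

variable {𝔤 : Type*} [LieRing 𝔤] [LieAlgebra ℂ 𝔤] [FiniteDimensional ℂ 𝔤] [IsKilling ℂ 𝔤]
  {𝔥 : LieSubalgebra ℂ 𝔤} [𝔥.IsCartanSubalgebra] {b : (rootSystem 𝔥).Base}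
  {e : Fin 6 ≃ b.support}
  (he : ∀ i j : Fin 6, b.cartanMatrix (e i) (e j) = CartanMatrix.E₆ i j)
  {L S : Finset E6Vec} {d : E6Vec} {φ : Module.Dual ℂ 𝔤} (hφ : IsE6Form e S d φ)
  (hS : ∀ s ∈ S, s ∈ e6Roots) (hL : ∀ v ∈ L, v ∈ e6Roots)
  {y : E6Vec → 𝔤} (hy : ∀ v, y v ∈ e6Space e v)
  (hperp : ∀ w ∈ L, w ∉ S → ∀ z ∈ e6Space e w, ∑ u ∈ L, φ ⁅y u, z⁆ = 0)
include he hφ hS hL hy hperp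

theorem eq_zero_of_mem_e6Eliminate {Z : Finset E6Vec} (hZ : ∀ v ∈ Z, y v = 0) :
    ∀ v ∈ e6Eliminate L S d Z, y v = 0 := by
  intro v hv
  obtain ⟨hvL, hvZ | ⟨w, hw, hwS, hvw, huniq⟩⟩ := Finset.mem_filter.mp hv
  · exact hZ v hvZ
  · obtain ⟨z, hz, hz0⟩ := exists_ne_zero_mem_e6Space (𝔤 := 𝔤) e he (hL w hw)
    have h := hperp w hw hwS z hz
    rw [Finset.sum_eq_single_of_mem v hvL] at h
    · by_contra h0
      exact hφ.lie_ne_zero he hS hvw (hL v hvL) (hL w hw) (hy v) h0 hz hz0 h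
    · intro u hu huv
      by_cases hadj : E6Adj S d u w
      · rw [hZ u ((huniq u hu hadj).resolve_left huv)]
        simp
      · exact hφ.lie_eq_zero hadj (hy u) hz

theorem eq_zero_of_mem_iterate_e6Eliminate {Z : Finset E6Vec} (hZ : ∀ v ∈ Z, y v = 0) (n : ℕ) :
    ∀ v ∈ (e6Eliminate L S d)^[n] Z, y v = 0 := by
  induction n with
  | zero => exact hZ
  | succ n ih =>
    rw [Function.iterate_succ_apply']
    exact eq_zero_of_mem_e6Eliminate he hφ hS hL hy hperp ih

/-- Elimination of the six components of a hexagon of roots `P i` and `P i + η`. The equations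
obtained from the `P i + η` relate the three components `y (P j)`, and those from the `P i` relate
the three components `y (P j + η)`. In terms of root vectors `aᵢ` for `P i` and `⁅E, aᵢ⁆` for `P i
+ η`, where `E` is a root vector for `η`, both systems have the matrix `φ ⁅aⱼ, ⁅E, aᵢ⁆⁆`, up to
sign and transposition. It is symmetric off the diagonal because `⁅E, ⁅aᵢ, aⱼ⁆⁆ = 0`. -/
theorem eq_zero_of_hexagon {Z : Finset E6Vec} (hZ : ∀ v ∈ Z, y v = 0) {P : Fin 3 → E6Vec}
    {η : E6Vec} (hη : η ∈ e6Roots) (hP : Function.Injective P)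
    (hPL : ∀ i, P i ∈ L ∧ P i ∉ S ∧ P i + η ∈ L ∧ P i + η ∉ S)
    (hPP : ∀ i j, i ≠ j → P i + P j ∉ e6Roots ∧ P i + P j ≠ 0 ∧ P i + (P j + η) ∈ S)
    (hadj : ∀ i, ∀ u ∈ L, E6Adj S d u (P i + η) → (∃ j, j ≠ i ∧ u = P j) ∨ u ∈ Z)
    (hadj' : ∀ i, ∀ u ∈ L, E6Adj S d u (P i) → (∃ j, j ≠ i ∧ u = P j + η) ∨ u ∈ Z) (i : Fin 3) :
    y (P i) = 0 ∧ y (P i + η) = 0 := by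
  have hroot (i) := hL _ (hPL i).1
  have hroot' (i) := hL _ (hPL i).2.2.1
  obtain ⟨E, hE, hE0⟩ := exists_ne_zero_mem_e6Space (𝔤 := 𝔤) e he hη
  choose a ha ha0 using fun i ↦ exists_ne_zero_mem_e6Space (𝔤 := 𝔤) e he (hroot i)
  have ha' (i) : ⁅E, a i⁆ ∈ e6Space e (P i + η) := by
    rw [add_comm]
    exact lie_mem_e6Space e hE (ha i)
  have ha0' (i) : ⁅E, a i⁆ ≠ 0 :=
    lie_ne_zero_of_mem_e6Space e he hη (hroot i) (by rw [add_comm]; exact hroot' i) hE hE0 (ha i)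
      (ha0 i)
  -- Root spaces are lines, so the unknown components are scalar multiples of the chosen vectors.
  choose c hc using fun i ↦ exists_smul_of_mem_e6Space e he (hroot i) (ha i) (ha0 i) (hy (P i))
  choose c' hc' using fun i ↦
    exists_smul_of_mem_e6Space e he (hroot' i) (ha' i) (ha0' i) (hy (P i + η))
  let m : Fin 3 → Fin 3 → ℂ := fun i j ↦ φ ⁅a j, ⁅E, a i⁆⁆
  have hm (i j) (hij : i ≠ j) : m i j = m j i := by
    have h0 : ⁅a i, a j⁆ = 0 := by
      have := lie_mem_e6Space e (ha i) (ha j)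
      rw [e6Space_eq_bot e he (hPP i j hij).1 (hPP i j hij).2.1] at this
      simpa using this
    have h1 : ⁅⁅E, a i⁆, a j⁆ + ⁅a i, ⁅E, a j⁆⁆ = 0 := by
      rw [← leibniz_lie, h0, lie_zero]
    have h2 : ⁅a j, ⁅E, a i⁆⁆ = ⁅a i, ⁅E, a j⁆⁆ := by
      rw [← lie_skew, neg_eq_iff_add_eq_zero, h1]
    exact congrArg φ h2
  have hm0 (i j) (hij : i ≠ j) : m i j ≠ 0 :=
    hφ.lie_ne_zero he hS (Or.inl (hPP j i hij.symm).2.2) (hroot j) (hroot' i) (ha j) (ha0 j)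
      (ha' i) (ha0' i)
  -- The equation obtained from `w`, when its neighbours outside `Z` are the `Q j` with `j ≠ i`.
  have hsum {w : E6Vec} (hw : w ∈ L) (hwS : w ∉ S) {z : 𝔤} (hz : z ∈ e6Space e w) (i : Fin 3)
      (Q : Fin 3 → E6Vec) (hQ : Function.Injective Q) (hQL : ∀ j, Q j ∈ L)
      (hadj : ∀ u ∈ L, E6Adj S d u w → (∃ j, j ≠ i ∧ u = Q j) ∨ u ∈ Z) :
      ∑ j ∈ {j | j ≠ i}, φ ⁅y (Q j), z⁆ = 0 := by
    rw [← hperp w hw hwS z hz, ← Finset.sum_image (f := fun u ↦ φ ⁅y u, z⁆) hQ.injOn]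
    refine Finset.sum_subset (fun u hu ↦ ?_) fun u hu hu' ↦ ?_
    · obtain ⟨j, -, rfl⟩ := Finset.mem_image.mp hu
      exact hQL j
    · by_cases hadj' : E6Adj S d u w
      · rcases hadj u hu hadj' with ⟨j, hj, rfl⟩ | hu0
        · exact absurd (Finset.mem_image.mpr ⟨j, by simpa using hj, rfl⟩) hu'
        · rw [hZ u hu0]
          simp
      · exact hφ.lie_eq_zero hadj' (hy u) hz
  have hcz : ∀ i, c i = 0 := by
    refine eq_zero_of_symm_offDiag hm hm0 fun i ↦ ?_
    rw [← hsum (hPL i).2.2.1 (hPL i).2.2.2 (ha' i) i P hP (fun j ↦ (hPL j).1) (hadj i)]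
    exact Finset.sum_congr rfl fun j _ ↦ by simp [hc, m]
  have hcz' : ∀ i, c' i = 0 := by
    refine eq_zero_of_symm_offDiag hm hm0 fun i ↦ ?_
    rw [← neg_eq_zero, ← hsum (hPL i).1 (hPL i).2.1 (ha i) i (fun j ↦ P j + η)
      (fun j k hjk ↦ hP (add_right_cancel hjk)) (fun j ↦ (hPL j).2.2.1) (hadj' i),
      ← Finset.sum_neg_distrib]
    refine Finset.sum_congr rfl fun j hj ↦ ?_
    rw [hm i j (by simpa [eq_comm] using hj), hc', smul_lie, map_smul, ← lie_skew, map_neg]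
    simp [m]
  rw [hc, hc', hcz, hcz']
  simp

end Elimination

/-! ### The combinatorial data of the two parabolic subalgebras -/

/-- The roots `-α₂ - α₄`, `α₂ + α₃ + α₄ + α₅` and `α₁ + α₂ + α₃ + α₄ + α₅ + α₆`. With their
translates by `α₄` they form a hexagon: the sum of one of the three and the translate of another
one is `s₁ = α₃ + α₄ + α₅`, `s₂ = α₁ + α₃ + α₄ + α₅ + α₆` or the highest root. -/
def e6Hexagon : Fin 3 → E6Vec :=
  ![![0, -1, 0, -1, 0, 0], ![0, 1, 1, 1, 1, 0], ![1, 1, 1, 1, 1, 1]]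

/-- The set `Z` together with the six roots of the hexagon. -/
def e6HexagonStep (Z : Finset E6Vec) : Finset E6Vec :=
  Z ∪ (Finset.univ.image e6Hexagon ∪ Finset.univ.image fun i ↦ e6Hexagon i + Pi.single 3 1)

/-- The combinatorial conditions on `J`, `S` and `d` under which a form `φ` with `IsE6Form e S d
φ` has a stabilizer in the parabolic subalgebra of `J` that lies in the Cartan subalgebra: the
elimination, carried out in `n` rounds, then on the hexagon, then in `k` more rounds, exhausts all
roots. -/
structure IsE6Eliminable (J : Finset (Fin 6)) (S : Finset E6Vec) (d : E6Vec) (n k : ℕ) :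
    Prop where
  /-- The negative roots of the parabolic subalgebra have height at least `-2`. -/
  parabolic : ∀ v ∈ e6ParabolicRoots J, v ∈ e6PosRoots ∨ (∃ j ∈ J, v = -Pi.single j 1) ∨
    ∃ i ∈ J, ∃ j ∈ J, v = -Pi.single i 1 + -Pi.single j 1
  subset : S ⊆ e6ParabolicRoots J
  /-- Linear independence of `S`, witnessed by a dual family up to scaling. -/
  dual : ∀ s ∈ S, ∃ c : E6Vec, ∑ i, s i * c i ≠ 0 ∧ ∀ t ∈ S, t ≠ s → ∑ i, t i * c i = 0
  hexagon_mem : ∀ i, e6Hexagon i ∈ e6ParabolicRoots J ∧ e6Hexagon i ∉ S ∧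
    e6Hexagon i + Pi.single 3 1 ∈ e6ParabolicRoots J ∧ e6Hexagon i + Pi.single 3 1 ∉ S
  hexagon_add : ∀ i j, i ≠ j → e6Hexagon i + e6Hexagon j ∉ e6Roots ∧
    e6Hexagon i + e6Hexagon j ≠ 0 ∧ e6Hexagon i + (e6Hexagon j + Pi.single 3 1) ∈ S
  hexagon_adj : ∀ i, ∀ u ∈ e6ParabolicRoots J, E6Adj S d u (e6Hexagon i + Pi.single 3 1) →
    (∃ j, j ≠ i ∧ u = e6Hexagon j) ∨ u ∈ (e6Eliminate (e6ParabolicRoots J) S d)^[n] S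
  hexagon_adj' : ∀ i, ∀ u ∈ e6ParabolicRoots J, E6Adj S d u (e6Hexagon i) →
    (∃ j, j ≠ i ∧ u = e6Hexagon j + Pi.single 3 1) ∨
      u ∈ (e6Eliminate (e6ParabolicRoots J) S d)^[n] S
  exhaust : e6ParabolicRoots J ⊆ (e6Eliminate (e6ParabolicRoots J) S d)^[k]
    (e6HexagonStep ((e6Eliminate (e6ParabolicRoots J) S d)^[n] S))

/-- The data for `{α₁, α₂, α₄}`: `S` consists of `-α₁`, `s₁`, `s₂` and the highest root. -/
theorem isE6Eliminable_of_three : IsE6Eliminable {0, 1, 3}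
    {![-1, 0, 0, 0, 0, 0], ![0, 0, 1, 1, 1, 0], ![1, 0, 1, 1, 1, 1], ![1, 2, 2, 3, 2, 1]}
    ![0, 0, 0, 1, 0, 0] 1 1 where
  parabolic := by decide +kernel
  subset := by decide +kernel
  dual := by
    simp only [Finset.forall_mem_insert, Finset.mem_singleton, forall_eq]
    exact ⟨⟨![2, 0, 0, 0, 0, -2], by decide +kernel⟩, ⟨![0, -1, 0, 0, 2, -2], by decide +kernel⟩,
      ⟨![0, -1, 0, 0, 0, 2], by decide +kernel⟩, ⟨![0, 1, 0, 0, 0, 0], by decide +kernel⟩⟩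
  hexagon_mem := by decide +kernel
  hexagon_add := by decide +kernel
  hexagon_adj := by decide +kernel
  hexagon_adj' := by decide +kernel
  exhaust := by decide +kernel

/-- The data for `{α₁, α₂, α₄, α₆}`: `S` consists of `s₁`, `s₂` and the highest root. -/
theorem isE6Eliminable_of_four : IsE6Eliminable {0, 1, 3, 5}
    {![0, 0, 1, 1, 1, 0], ![1, 0, 1, 1, 1, 1], ![1, 2, 2, 3, 2, 1]}
    ![0, 0, 0, 1, 0, 1] 3 1 where
  parabolic := by decide +kernel
  subset := by decide +kernel
  dual := by
    simp only [Finset.forall_mem_insert, Finset.mem_singleton, forall_eq]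
    exact ⟨⟨![-2, -1, 0, 0, 2, 0], by decide +kernel⟩,
      ⟨![2, -1, 0, 0, 0, 0], by decide +kernel⟩, ⟨![0, 1, 0, 0, 0, 0], by decide +kernel⟩⟩
  hexagon_mem := by decide +kernel
  hexagon_add := by decide +kernel
  hexagon_adj := by decide +kernel
  hexagon_adj' := by decide +kernel
  exhaust := by decide +kernel

/-! ### Quasi-reductivity -/

section Main

variable {𝔤 : Type*} [LieRing 𝔤] [LieAlgebra ℂ 𝔤] [FiniteDimensional ℂ 𝔤] [IsKilling ℂ 𝔤]
  {𝔥 : LieSubalgebra ℂ 𝔤} [𝔥.IsCartanSubalgebra] {b : (rootSystem 𝔥).Base}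
  (e : Fin 6 ≃ b.support)
  (he : ∀ i j : Fin 6, b.cartanMatrix (e i) (e j) = CartanMatrix.E₆ i j)
include he

theorem isQuasiReductive_standardParabolic {J : Finset (Fin 6)} {S : Finset E6Vec} {d : E6Vec}
    {n k : ℕ} (H : IsE6Eliminable J S d n k) :
    IsQuasiReductive (standardParabolic 𝔥 b ((fun i ↦ e i) '' (J : Set (Fin 6)))) := by
  have hL : ∀ v ∈ e6ParabolicRoots J, v ∈ e6Roots := fun v hv ↦ (mem_e6ParabolicRoots.mp hv).1
  have hS : ∀ s ∈ S, s ∈ e6Roots := fun s hs ↦ hL s (H.subset hs)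
  obtain ⟨φ, hφ⟩ := exists_isE6Form (𝔤 := 𝔤) e he S hS d
  have hle {v : E6Vec} (hv : v ∈ e6ParabolicRoots J) {z : 𝔤} (hz : z ∈ e6Space e v) :
      z ∈ standardParabolic 𝔥 b ((fun i ↦ e i) '' (J : Set (Fin 6))) :=
    e6Space_le_standardParabolic e he J H.parabolic hv hz
  refine ⟨φ ∘ₗ (standardParabolic 𝔥 b _).toSubmodule.subtype,
    isOfReductiveType_of_stabilizer_le_cartan 𝔥 _ _ fun ⟨x, hx⟩ hstab ↦ ?_⟩
  obtain ⟨h, y, hy, rfl⟩ := exists_eq_add_sum_of_mem_standardParabolic e he J hx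
  have hstab' : ∀ z ∈ standardParabolic 𝔥 b ((fun i ↦ e i) '' (J : Set (Fin 6))),
      φ ⁅(h : 𝔤), z⁆ + ∑ v ∈ e6ParabolicRoots J, φ ⁅y v, z⁆ = 0 := fun z hz ↦ by
    have := hstab ⟨z, hz⟩
    rw [← map_sum, ← map_add, ← sum_lie, ← add_lie]
    exact this
  -- Testing on root vectors outside `S`, on which the Cartan component of `x` does not contribute.
  have hperp : ∀ w ∈ e6ParabolicRoots J, w ∉ S → ∀ z ∈ e6Space e w,
      ∑ u ∈ e6ParabolicRoots J, φ ⁅y u, z⁆ = 0 := fun w hw hwS z hz ↦ by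
    have h0 : w ≠ 0 := fun h ↦ zero_notMem_e6Roots (h ▸ hL w hw)
    rw [← hstab' z (hle hw hz), lie_eq_e6Weight_smul e hz, map_smul, hφ.eq_zero w h0 hwS z hz]
    simp
  -- `S` is linearly independent, so testing on the Cartan subalgebra kills the components in `S`.
  have hyS : ∀ s ∈ S, y s = 0 := by
    intro s hs
    obtain ⟨c, hc, hc'⟩ := H.dual s hs
    obtain ⟨t, ht⟩ := exists_forall_e6Weight_eq e c
    have ht𝔭 : (t : 𝔤) ∈ standardParabolic 𝔥 b ((fun i ↦ e i) '' (J : Set (Fin 6))) :=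
      LieSubalgebra.subset_lieSpan (Or.inl (Or.inl t.2))
    have key := hstab' t ht𝔭
    have hht : ⁅(h : 𝔤), (t : 𝔤)⁆ = 0 :=
      congrArg (fun z : 𝔥 ↦ (z : 𝔤)) (trivial_lie_zero 𝔥 𝔥 h t)
    have hterm (v : E6Vec) : φ ⁅y v, (t : 𝔤)⁆ = -(((∑ i, v i * c i : ℤ) : ℂ) * φ (y v)) := by
      rw [← lie_skew, map_neg, lie_eq_e6Weight_smul e (hy v), map_smul, ht, smul_eq_mul]
    rw [hht, map_zero, zero_add, Finset.sum_eq_single_of_mem s (H.subset hs), hterm] at key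
    · by_contra h0
      exact mul_ne_zero (by exact_mod_cast hc) (hφ.ne_zero s hs _ (hy s) h0) (neg_eq_zero.mp key)
    · intro v hv hvs
      rw [hterm]
      by_cases hvS : v ∈ S
      · rw [hc' v hvS hvs]
        simp
      · have h0 : v ≠ 0 := fun h ↦ zero_notMem_e6Roots (h ▸ hL v hv)
        rw [hφ.eq_zero v h0 hvS _ (hy v)]
        simp
  have hZ := eq_zero_of_mem_iterate_e6Eliminate he hφ hS hL hy hperp hyS n
  have hex := eq_zero_of_hexagon he hφ hS hL hy hperp hZ
    (List.mem_append_left _ (single_mem_e6PosRoots 3)) (by decide +kernel) H.hexagon_mem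
    H.hexagon_add H.hexagon_adj H.hexagon_adj'
  have hZ' : ∀ v ∈ e6HexagonStep ((e6Eliminate (e6ParabolicRoots J) S d)^[n] S), y v = 0 := by
    intro v hv
    rcases Finset.mem_union.mp hv with hv | hv
    · exact hZ v hv
    · rcases Finset.mem_union.mp hv with hv | hv
      · obtain ⟨i, -, rfl⟩ := Finset.mem_image.mp hv
        exact (hex i).1
      · obtain ⟨i, -, rfl⟩ := Finset.mem_image.mp hv
        exact (hex i).2
  have hall : ∀ v ∈ e6ParabolicRoots J, y v = 0 := fun v hv ↦
    eq_zero_of_mem_iterate_e6Eliminate he hφ hS hL hy hperp hZ' k v (H.exhaust hv)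
  change (h : 𝔤) + ∑ v ∈ e6ParabolicRoots J, y v ∈ 𝔥
  rw [Finset.sum_eq_zero hall, add_zero]
  exact h.2

end Main

/-- `𝔤` is a complex simple Lie algebra of type `E₆`, `𝔥` a Cartan subalgebra, `b` a base of its root
system, and `α₁, …, α₆` (here `e 0, …, e 5`) its simple roots in the Bourbaki numbering, in which
`α₁ - α₃ - α₄ - α₅ - α₆` is a chain and `α₂` is joined to `α₄`. -/
theorem theorem5p7 {𝔤 : Type*} [LieRing 𝔤] [LieAlgebra ℂ 𝔤] [FiniteDimensional ℂ 𝔤]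
    [LieAlgebra.IsSimple ℂ 𝔤] (𝔥 : LieSubalgebra ℂ 𝔤) [𝔥.IsCartanSubalgebra]
    (b : (LieAlgebra.IsKilling.rootSystem 𝔥).Base) (e : Fin 6 ≃ b.support)
    (he : ∀ i j : Fin 6, b.cartanMatrix (e i) (e j) = CartanMatrix.E₆ i j) :
    IsQuasiReductive (standardParabolic 𝔥 b {e 0, e 1, e 3}) ∧
      IsQuasiReductive (standardParabolic 𝔥 b {e 0, e 1, e 3, e 5}) := by
  have h1 : (fun i ↦ e i) '' (({0, 1, 3} : Finset (Fin 6)) : Set (Fin 6)) =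
      {e 0, e 1, e 3} := by
    simp [Set.image_insert_eq]
  have h2 : (fun i ↦ e i) '' (({0, 1, 3, 5} : Finset (Fin 6)) : Set (Fin 6)) =
      {e 0, e 1, e 3, e 5} := by
    simp [Set.image_insert_eq]
  rw [← h1, ← h2]
  exact ⟨isQuasiReductive_standardParabolic e he isE6Eliminable_of_three,
    isQuasiReductive_standardParabolic e he isE6Eliminable_of_four⟩
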